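/- **Theorem 3.24 (Structure theorem for exchangeable random partite hypergraph colourings).** Let $k\le d$ be non-negative integers, let $[d]=\{1,\dots,d\}$, let $S_1,\dots,S_d$ be disjoint countably infinite sets, and let $K_e$ be a standard Borel space for each $e\subseteq[d]$ with $|e|=k$. Let $\mu$ be a probability measure on the product space $$\prod_{e\subseteq[d],\,|e|=k} K_e^{\prod_{i\in e}S_i}$$ that is exchangeable: for every choice of finitely supported permutations $g_i$ of $S_i$ $(i\in[d])$, $\mu$ is invariant under the map $(\omega_{e,w})_{e,w}\mapsto(\omega_{e,(g_i(w_i))_{i\in e}})_{e,w}$. Then there are * standard Borel spaces $Z_b$ for all $b\subseteq[d]$ with $|b|\le k$, where $Z_e=K_e$ (as measurable spaces, up to isomorphism) when $|e|=k$; * a probability measure $\mu_0$ on $Z_\emptyset$; and * a probability kernel $P_c$ from $\prod_{b\subsetneq c}Z_b$ to $Z_c$ for every nonempty $c\subseteq[d]$ with $|c|\le k$, such that $\mu$ is the law of the random colouring $(z_{w})_{|e|=k,\;w\in\prod_{i\in e}S_i}$ produced by the following recipe. First choose $z_\emptyset\in Z_\emptyset$ with law $\mu_0$. Then, successively for $j=1,\dots,k$,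 given all the choices made so far, choose $z_u\in Z_c$ for all $c\subseteq[d]$ with $|c|=j$ and all $u\in\prod_{i\in c}S_i$, independently, with $z_u$ of law $P_c\big((z_{u|_b})_{b\subsetneq c},\,\cdot\,\big)$, where $u|_b=(u_i)_{i\in b}$. (For $k=0$ the recipe stops after the choice of $z_\emptyset$.) -/

import Mathlib

open MeasureTheory ProbabilityTheory

universe u v

/-- The subsets `b ⊆ [d]` with `|b| ≤ k`. -/
abbrev Face (d k : ℕ) : Type := {b : Finset (Fin d) // b.card ≤ k}

/-- The subsets `e ⊆ [d]` with `|e| = k`. -/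
abbrev TopFace (d k : ℕ) : Type := {e : Finset (Fin d) // e.card = k}

/-- A top face, as a face. -/
abbrev TopFace.toFace {d k : ℕ} (e : TopFace d k) : Face d k := ⟨e.1, e.2.le⟩

/-- The empty face. -/
abbrev Face.empty (d k : ℕ) : Face d k := ⟨∅, by simp⟩

/-- The hyperedges above `b`: the points of `∏_{i ∈ b} S_i`. -/
abbrev EdgeAbove {d : ℕ} (S : Fin d → Type v) (b : Finset (Fin d)) : Type v := ∀ i : b, S i

/-- The space `∏_{|e| = k} K_e ^ (∏_{i ∈ e} S_i)` of colourings of the complete `d`-partite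
`k`-uniform hypergraph, with its product σ-algebra. -/
abbrev PartiteColouring {d k : ℕ} (S : Fin d → Type v) (K : TopFace d k → Type u) :
    Type (max u v) :=
  ∀ e : TopFace d k, EdgeAbove S e.1 → K e

/-- The coordinate-permuting action of a family of permutations of the vertex classes. -/
def PartiteColouring.permute {d k : ℕ} {S : Fin d → Type v} {K : TopFace d k → Type u}
    (g : ∀ i, Equiv.Perm (S i)) (ω : PartiteColouring S K) : PartiteColouring S K :=
  fun e w => ω e (fun i => g i (w i))

/-- A law on colourings is exchangeable if it is invariant under all separate finitely supported
permutations of the vertex classes. -/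
def PartiteExchangeable {d k : ℕ} {S : Fin d → Type v} {K : TopFace d k → Type u}
    [∀ e, MeasurableSpace (K e)] (μ : Measure (PartiteColouring S K)) : Prop :=
  ∀ g : ∀ i, Equiv.Perm (S i), (∀ i, {s | g i s ≠ s}.Finite) →
    μ.map (PartiteColouring.permute g) = μ

/-- Ingredients for a random colouring with colour spaces `K_e`, `|e| = k`: standard Borel spaces
`Z_b` for `|b| ≤ k`, with `Z_e` identified with `K_e` as a measurable space when `|e| = k`, a
probability measure `μ₀` on `Z_∅`, and for every nonempty `c` with `|c| ≤ k` a probability kernel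
`P_c` from `∏_{b ⊊ c} Z_b` to `Z_c`. -/
structure PartiteIngredients {d k : ℕ} (K : TopFace d k → Type u)
    [∀ e, MeasurableSpace (K e)] where
  Z : Face d k → Type u
  measurableSpace : ∀ b, MeasurableSpace (Z b)
  standardBorel : ∀ b, StandardBorelSpace (Z b)
  top : ∀ e : TopFace d k, Z e.toFace ≃ᵐ K e
  μ₀ : Measure (Z (Face.empty d k))
  isProbabilityMeasure : IsProbabilityMeasure μ₀
  P : ∀ c : Face d k, c.1.Nonempty → Kernel (∀ b : {b : Face d k // b.1 ⊂ c.1}, Z b.1) (Z c)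
  isMarkovKernel : ∀ c hc, IsMarkovKernel (P c hc)

attribute [instance] PartiteIngredients.measurableSpace PartiteIngredients.standardBorel
  PartiteIngredients.isProbabilityMeasure PartiteIngredients.isMarkovKernel

/-- The hyperedges of all ranks `≤ k`: pairs of `b` with `|b| ≤ k` and a hyperedge above `b`. -/
abbrev PartiteEdge {d : ℕ} (S : Fin d → Type v) (k : ℕ) : Type v :=
  Σ b : Face d k, EdgeAbove S b.1

/-- The restriction `u|_b` of a hyperedge `u` above `c` to a subset `b ⊆ c`. -/
def PartiteEdge.restrict {d k : ℕ} {S : Fin d → Type v} (t : PartiteEdge S k) (b : Face d k)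
    (h : b.1 ⊆ t.1.1) : PartiteEdge S k :=
  ⟨b, Finset.restrict₂ h t.2⟩

/-- The product of a family of probability kernels with a common source:
`y ↦ ⨂ i, κ i (y, ·)`. -/
noncomputable def productKernel {Y : Type*} [MeasurableSpace Y] {ι : Type*} {X : ι → Type*}
    [∀ i, MeasurableSpace (X i)] (κ : ∀ i, Kernel Y (X i)) [∀ i, IsMarkovKernel (κ i)] :
    Kernel Y (∀ i, X i) where
  toFun y := Measure.infinitePi fun i => κ i y
  measurable' := by
    refine Measurable.measure_of_isPiSystem_of_isProbabilityMeasure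
      (S := squareCylinders fun i => {s : Set (X i) | MeasurableSet s})
      generateFrom_squareCylinders.symm
      (isPiSystem_squareCylinders (fun i => MeasurableSpace.isPiSystem_measurableSet)
        (fun i => MeasurableSet.univ)) ?_
    rintro _ ⟨s, t, ht, rfl⟩
    simp only [Set.mem_pi, Set.mem_univ, Set.mem_ofPred_eq, forall_const] at ht
    simp_rw [Measure.infinitePi_pi _ (fun i _ => ht i)]
    exact Finset.measurable_prod _ fun i _ => (κ i).measurable_coe (ht i)

namespace PartiteIngredients

variable {d k : ℕ} {K : TopFace d k → Type u} [∀ e, MeasurableSpace (K e)]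
  (I : PartiteIngredients K) (S : Fin d → Type v)

/-- The choices `z_u` made at the hyperedges `u` of rank at most `j`. -/
abbrev History (j : ℕ) : Type (max u v) :=
  ∀ t : {t : PartiteEdge S k // t.1.1.card ≤ j}, I.Z t.1.1

/-- The choices `z_u` made at the hyperedges `u` of rank exactly `j`. -/
abbrev Layer (j : ℕ) : Type (max u v) :=
  ∀ t : {t : PartiteEdge S k // t.1.1.card = j}, I.Z t.1.1

/-- The history of rank `0`, which consists of the single choice `z_∅`. -/
def historyZero (z : I.Z (Face.empty d k)) : I.History S 0 := fun t =>
  have h : Face.empty d k = t.1.1 :=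
    Subtype.ext (Finset.card_eq_zero.1 (Nat.le_zero.1 t.2)).symm
  h ▸ z

theorem nonempty_of_card_eq_succ {j : ℕ} (t : {t : PartiteEdge S k // t.1.1.card = j + 1}) :
    t.1.1.1.Nonempty :=
  Finset.card_pos.1 (by rw [t.2]; exact j.succ_pos)

/-- The choices `(z_{u|b})_{b ⊊ c}` that are relevant for a hyperedge `u` of rank `j + 1` above
`c`. -/
def boundary {j : ℕ} (t : {t : PartiteEdge S k // t.1.1.card = j + 1}) (z : I.History S j) :
    ∀ b : {b : Face d k // b.1 ⊂ t.1.1.1}, I.Z b.1 := fun b =>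
  z ⟨t.1.restrict b.1 b.2.subset,
    Nat.le_of_lt_succ (lt_of_lt_of_eq (Finset.card_lt_card b.2) t.2)⟩

theorem measurable_boundary {j : ℕ} (t : {t : PartiteEdge S k // t.1.1.card = j + 1}) :
    Measurable (I.boundary S t) :=
  measurable_pi_lambda _ fun _ => measurable_pi_apply _

/-- One step of the recipe: given the choices at rank at most `j`, choose `z_u` for the hyperedges
`u` of rank `j + 1` independently, with law `P_c((z_{u|b})_{b ⊊ c}, ·)` when `u` is above `c`. -/
noncomputable def step (j : ℕ) : Kernel (I.History S j) (I.Layer S (j + 1)) :=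
  haveI : ∀ t : {t : PartiteEdge S k // t.1.1.card = j + 1}, IsMarkovKernel
      ((I.P t.1.1 (nonempty_of_card_eq_succ S t)).comap (I.boundary S t)
        (I.measurable_boundary S t)) := fun _ => Kernel.IsMarkovKernel.comap _ _
  productKernel fun t => (I.P t.1.1 (nonempty_of_card_eq_succ S t)).comap
    (I.boundary S t) (I.measurable_boundary S t)

/-- Join the choices at rank at most `j` and those at rank `j + 1`. -/
def join (j : ℕ) (p : I.History S j × I.Layer S (j + 1)) : I.History S (j + 1) := fun t =>
  if h : t.1.1.1.card ≤ j then p.1 ⟨t.1, h⟩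
  else p.2 ⟨t.1, le_antisymm t.2 (Nat.lt_of_not_le h)⟩

/-- The joint law of the choices at rank at most `j` that are made in the standard recipe. -/
noncomputable def law : (j : ℕ) → Measure (I.History S j)
  | 0 => I.μ₀.map (I.historyZero S)
  | j + 1 => (law j ⊗ₘ I.step S j).map (I.join S j)

/-- The colouring that the choices at rank at most `k` determine: the choices at rank `k`. -/
def colouring (z : I.History S k) : PartiteColouring S K := fun e w =>
  I.top e (z ⟨⟨e.toFace, w⟩, e.2.le⟩)

/-- The ingredients yield `μ`: the colouring produced by the standard recipe has law `μ`. -/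
def Yields {S : Fin d → Type v} (μ : Measure (PartiteColouring S K)) : Prop :=
  (I.law S k).map (I.colouring S) = μ

end PartiteIngredients

/-! Split each `S i` into a copy of itself (`main`) and an infinite reservoir of auxiliary vertices
(`aux`). To a hyperedge `t` attach as hidden variable its link: the colours of all top hyperedges
that consist of the main copy of `t` and auxiliary vertices elsewhere. These link colourings are the
spaces `Z_b`. Above a top face the link is a single colour.

The main point is that the link of `t` is conditionally independent of all colours at hyperedges not
containing `t`, given the links of the proper restrictions of `t` (`measure_link_inter`). By
exchangeability, reindexing by any injections preserves `μ`. Choose injections fixing `t` and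
finitely many auxiliary vertices, and sending every other vertex into the reservoir. A cylinder
event in the link of `t` that uses only those fixed vertices is unchanged, while every hyperedge not
containing `t` lands in the link of a proper restriction of `t`. An L² argument
(`condExp_ae_eq_of_measurePreserving`) then shows that the larger σ-algebra adds no information.

Hence links of equal rank are independent given those of lower rank, with kernels depending only on
the face. The recipe run with these kernels produces the joint law of the links, and at rank `k`
this is the colouring of the main copy, which has law `μ`. -/

/-! ### Cylinder sets and extension of injections -/

theorem MeasureTheory.Measure.ext_of_finset_pi {ι : Type*} {X : ι → Type*}
    [∀ i, MeasurableSpace (X i)] {μ ν : Measure (∀ i, X i)} [IsFiniteMeasure μ]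
    (h : ∀ (s : Finset ι) (B : ∀ i, Set (X i)), (∀ i, MeasurableSet (B i)) →
      μ (Set.pi s B) = ν (Set.pi s B)) : μ = ν := by
  refine ext_of_generate_finite _ generateFrom_squareCylinders.symm
    (isPiSystem_squareCylinders (fun i => MeasurableSpace.isPiSystem_measurableSet)
      (fun i => MeasurableSet.univ)) ?_ ?_
  · rintro _ ⟨s, t, ht, rfl⟩
    simp only [Set.mem_pi, Set.mem_univ, Set.mem_ofPred_eq, forall_const] at ht
    exact h s t ht
  · simpa using h ∅ (fun _ => Set.univ) (fun _ => MeasurableSet.univ)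

/-- Correct the values one point at a time by a transposition; injectivity of `f` keeps the earlier
values intact. -/
theorem Equiv.Perm.exists_finite_support_eqOn {α : Type*} {f : α → α} (hf : f.Injective)
    (s : Finset α) : ∃ g : Equiv.Perm α, {a | g a ≠ a}.Finite ∧ ∀ a ∈ s, g a = f a := by
  classical
  induction s using Finset.induction_on with
  | empty => exact ⟨1, by simp, by simp⟩
  | insert a s ha ih =>
    obtain ⟨g, hg, hgs⟩ := ih
    refine ⟨Equiv.swap (g a) (f a) * g, ?_, ?_⟩
    · refine (hg.union (Set.toFinite {g⁻¹ (g a), g⁻¹ (f a)})).subset fun x hx => ?_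
      by_contra hx'
      simp only [Set.mem_union, Set.mem_ofPred_eq, Set.mem_insert_iff, Set.mem_singleton_iff,
        not_or, not_not, Equiv.Perm.eq_inv_iff_eq] at hx'
      obtain ⟨h1, h2, h3⟩ := hx'
      apply hx
      rw [Equiv.Perm.mul_apply, Equiv.swap_apply_of_ne_of_ne h2 h3, h1]
    · intro x hx
      rcases Finset.mem_insert.1 hx with rfl | hx
      · simp
      · have hxa : x ≠ a := fun h => ha (h ▸ hx)
        rw [Equiv.Perm.mul_apply, Equiv.swap_apply_of_ne_of_ne (g.injective.ne hxa)
          (by rw [hgs x hx]; exact hf.ne hxa), hgs x hx]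

/-- An injection of a countable set into the union of a set `A` of fixed points and an infinite
sequence, a given initial segment of which it fixes. -/
theorem exists_injective_fixing_initial_segment {α : Type*} [Countable α] {τ : ℕ → α}
    (hτ : τ.Injective) {A : Set α} (hA : ∀ a ∈ A, a ∉ Set.range τ) (N : ℕ) :
    ∃ f : α → α, f.Injective ∧ (∀ a ∈ A, f a = a) ∧ (∀ n < N, f (τ n) = τ n) ∧
      ∀ a ∉ A, f a ∈ Set.range τ := by
  classical
  obtain ⟨e, he⟩ := exists_injective_nat α
  -- Points of `F` stay fixed; all others are numbered by `e` and placed in the tail of `τ` beyond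
  -- `N`, which misses `F`.
  let F : Set α := A ∪ τ '' Set.Iio N
  have hF : ∀ a ∈ F, ∀ n, a ≠ τ (N + n) := by
    rintro a (ha | ⟨m, hm, rfl⟩) n h
    · exact hA a ha ⟨_, h.symm⟩
    · have := hτ h
      simp only [Set.mem_Iio] at hm
      omega
  refine ⟨fun a => if a ∈ F then a else τ (N + e a), ?_, ?_, ?_, ?_⟩
  · intro a b hab
    by_cases ha : a ∈ F <;> by_cases hb : b ∈ F <;> simp only [ha, hb, if_true, if_false] at hab
    · exact hab
    · exact absurd hab (hF a ha _)
    · exact absurd hab.symm (hF b hb _)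
    · exact he (by simpa using hτ hab)
  · intro a ha
    exact if_pos (Or.inl ha)
  · intro n hn
    exact if_pos (Or.inr ⟨n, hn, rfl⟩)
  · intro a ha
    by_cases h : a ∈ F
    · simp only [h, if_true]
      rcases h with h | ⟨n, -, rfl⟩
      · exact absurd h ha
      · exact ⟨n, rfl⟩
    · simp only [h, if_false]
      exact ⟨_, rfl⟩

/-! ### Conditional expectation and measure-preserving maps -/

/-- If a measure-preserving map `Φ` pulls `m₂` back into the smaller σ-algebra `m₁` and fixes `D`,
then `m₂` carries no more information about `D` than `m₁`. -/
theorem condExp_ae_eq_of_measurePreserving {Ω : Type*} {m₁ m₂ m₀ : MeasurableSpace Ω}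
    {μ : Measure Ω} [IsProbabilityMeasure μ] (h₁₂ : m₁ ≤ m₂) (h₂ : m₂ ≤ m₀) {Φ : Ω → Ω}
    (hΦ : MeasurePreserving Φ μ μ) (hΦm : Measurable[m₁, m₂] Φ) {D : Ω → ℝ} (hD : MemLp D 2 μ)
    (hDΦ : D ∘ Φ = D) : μ[D|m₂] =ᵐ[μ] μ[D|m₁] := by
  set f := μ[D|m₂] with hf
  have hfm : StronglyMeasurable[m₂] f := stronglyMeasurable_condExp
  have hf2 : MemLp f 2 μ := hD.condExp one_le_two
  have hgm : StronglyMeasurable[m₁] (f ∘ Φ) := hfm.comp_measurable hΦm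
  have hg2 : MemLp (f ∘ Φ) 2 μ := hf2.comp_measurePreserving hΦ
  have hDi : Integrable D μ := hD.integrable one_le_two
  have hcomp : ∀ F : Ω → ℝ, MemLp F 1 μ → ∫ x, F (Φ x) ∂μ = ∫ x, F x ∂μ := by
    intro F hF
    have := integral_map hΦ.measurable.aemeasurable (f := F)
      (by rw [hΦ.map_eq]; exact hF.aestronglyMeasurable)
    rw [← this, hΦ.map_eq]
  have hpull : ∀ H : Ω → ℝ, StronglyMeasurable[m₂] H → MemLp H 2 μ →
      ∫ x, D x * H x ∂μ = ∫ x, f x * H x ∂μ := by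
    intro H hH hH2
    have h1 := condExp_mul_of_stronglyMeasurable_right (μ := μ) (f := D) hH
      (hD.integrable_mul hH2) hDi
    have h2 := integral_condExp (μ := μ) (f := D * H) h₂
    rw [integral_congr_ae h1] at h2
    exact h2.symm
  -- Both sides are integrals against `D`: `f ∘ Φ` is `m₂`-measurable, and `D * (f ∘ Φ) = (D * f) ∘
  -- Φ` since `Φ` fixes `D`.
  have e1 : ∫ x, f x * f (Φ x) ∂μ = ∫ x, f x * f x ∂μ := by
    rw [← hpull _ hfm hf2]
    refine (hpull (f ∘ Φ) (hgm.mono h₁₂) hg2).symm.trans ?_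
    rw [← hcomp (fun x => D x * f x) (memLp_one_iff_integrable.2 (hD.integrable_mul hf2))]
    refine integral_congr_ae (.of_forall fun x => ?_)
    simp only [Function.comp_apply]
    rw [show D (Φ x) = D x from congrFun hDΦ x]
  have e2 : ∫ x, f (Φ x) * f (Φ x) ∂μ = ∫ x, f x * f x ∂μ :=
    hcomp (fun x => f x * f x) (memLp_one_iff_integrable.2 (hf2.integrable_mul hf2))
  have e3 : ∫ x, (f x - f (Φ x)) ^ 2 ∂μ = 0 := by
    have : ∀ x, (f x - f (Φ x)) ^ 2 =
        f x * f x - 2 * (f x * f (Φ x)) + f (Φ x) * f (Φ x) := fun x => by ring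
    simp_rw [this]
    have i1 : Integrable (fun x => f x * f x) μ := hf2.integrable_mul hf2
    have i2 : Integrable (fun x => 2 * (f x * f (Φ x))) μ := (hf2.integrable_mul hg2).const_mul 2
    have i3 : Integrable (fun x => f (Φ x) * f (Φ x)) μ := hg2.integrable_mul hg2
    have i4 : Integrable (fun x => f x * f x - 2 * (f x * f (Φ x))) μ := i1.sub i2
    rw [integral_add i4 i3, integral_sub i1 i2, integral_const_mul, e1, e2]
    ring
  -- Thus `f` agrees almost everywhere with an `m₁`-measurable function, and the tower property
  -- finishes.
  have e4 : f =ᵐ[μ] f ∘ Φ := by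
    have hi : Integrable (fun x => (f x - f (Φ x)) ^ 2) μ := (hf2.sub hg2).integrable_sq
    rw [integral_eq_zero_iff_of_nonneg (fun x => sq_nonneg _) hi] at e3
    filter_upwards [e3] with x hx
    have : f x - f (Φ x) = 0 := by simpa using hx
    simpa using sub_eq_zero.1 this
  calc f =ᵐ[μ] f ∘ Φ := e4
    _ = μ[f ∘ Φ|m₁] :=
      (condExp_of_stronglyMeasurable (h₁₂.trans h₂) hgm (hg2.integrable one_le_two)).symm
    _ =ᵐ[μ] μ[f|m₁] := condExp_congr_ae e4.symm
    _ =ᵐ[μ] μ[D|m₁] := condExp_condExp_of_le h₁₂ h₂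

/-! ### Invariance under injections -/

namespace PartiteColouring

variable {d k : ℕ} {S : Fin d → Type v} {K : TopFace d k → Type u}

/-- The reindexing of colourings by a family of maps of the vertex classes. -/
def reindex (f : ∀ i, S i → S i) (ω : PartiteColouring S K) : PartiteColouring S K :=
  fun e w => ω e (fun i => f i (w i))

variable [∀ e, MeasurableSpace (K e)]

theorem measurable_reindex (f : ∀ i, S i → S i) :
    Measurable (reindex f : PartiteColouring S K → PartiteColouring S K) := by
  unfold reindex
  fun_prop

end PartiteColouring

/-- A cylinder event involves finitely many vertices, and on these the injections agree with
finitely supported permutations. -/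
theorem PartiteExchangeable.measurePreserving_reindex {d k : ℕ} {S : Fin d → Type v}
    {K : TopFace d k → Type u} [∀ e, MeasurableSpace (K e)] {μ : Measure (PartiteColouring S K)}
    [IsProbabilityMeasure μ] (hμ : PartiteExchangeable μ) {f : ∀ i, S i → S i}
    (hf : ∀ i, (f i).Injective) : MeasurePreserving (PartiteColouring.reindex f) μ μ := by
  classical
  refine ⟨PartiteColouring.measurable_reindex f, ?_⟩
  let E := MeasurableEquiv.piCurry (fun (e : TopFace d k) (_ : EdgeAbove S e.1) => K e)
  refine E.symm.map_measurableEquiv_injective ?_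
  have hr := PartiteColouring.measurable_reindex (K := K) f
  have := Measure.isProbabilityMeasure_map (μ := μ) hr.aemeasurable
  have := Measure.isProbabilityMeasure_map
    (μ := μ.map (PartiteColouring.reindex f)) E.symm.measurable.aemeasurable
  refine Measure.ext_of_finset_pi fun s B hB => ?_
  have hpi : MeasurableSet (Set.pi (s : Set (Σ e : TopFace d k, EdgeAbove S e.1)) B) :=
    MeasurableSet.pi s.countable_toSet fun i _ => hB i
  have hfin : ∀ i, {x : S i | ∃ p ∈ s, ∃ h : i ∈ p.1.1, p.2 ⟨i, h⟩ = x}.Finite := by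
    intro i
    have : {x : S i | ∃ p ∈ s, ∃ h : i ∈ p.1.1, p.2 ⟨i, h⟩ = x} ⊆
        ⋃ p ∈ s, {x | ∃ h : i ∈ p.1.1, p.2 ⟨i, h⟩ = x} := by
      rintro x ⟨p, hp, h⟩
      simp only [Set.mem_iUnion]
      exact ⟨p, hp, h⟩
    refine (s.finite_toSet.biUnion fun p _ => Set.Subsingleton.finite ?_).subset this
    rintro _ ⟨_, rfl⟩ _ ⟨_, rfl⟩
    rfl
  choose g hg hgf using fun i => Equiv.Perm.exists_finite_support_eqOn (hf i) (hfin i).toFinset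
  rw [E.symm.map_apply, Measure.map_apply hr (E.symm.measurable hpi), E.symm.map_apply]
  conv_rhs => rw [← hμ g hg]
  change _ = μ.map (PartiteColouring.reindex fun i => g i) _
  rw [Measure.map_apply
    (PartiteColouring.measurable_reindex fun i => g i) (E.symm.measurable hpi)]
  congr 1
  ext ω
  simp only [Set.mem_preimage, Set.mem_pi]
  refine forall₂_congr fun p hp => ?_
  have : (fun i : p.1.1 => f i (p.2 i)) = fun i : p.1.1 => g i (p.2 i) := by
    funext i
    exact (hgf i _ ((hfin i).mem_toFinset.2 ⟨p, hp, i.2, rfl⟩)).symm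
  change ω p.1 (fun i => f i (p.2 i)) ∈ B p ↔ ω p.1 (fun i => g i (p.2 i)) ∈ B p
  rw [this]

/-! ### Vertex splittings and links -/

/-- The edges above a top face `e ⊇ c` in an auxiliary vertex set `ℕ`, restricted to `e ∖ c`. -/
abbrev LinkIndex {d : ℕ} (k : ℕ) (c : Finset (Fin d)) : Type :=
  Σ e : {e : TopFace d k // c ⊆ e.1}, ({i // i ∈ e.1.1 ∧ i ∉ c} → ℕ)

/-- The colourings of the link of a hyperedge above `c` within an auxiliary vertex set. -/
abbrev LinkColouring {d k : ℕ} (K : TopFace d k → Type u) (c : Finset (Fin d)) : Type u :=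
  ∀ p : LinkIndex k c, K p.1.1

/-- The link of a hyperedge above a top face is that hyperedge alone. -/
instance LinkIndex.unique {d k : ℕ} (e : TopFace d k) : Unique (LinkIndex k e.1) where
  default := ⟨⟨e, subset_rfl⟩, fun _ => 0⟩
  uniq := by
    rintro ⟨⟨e', he⟩, p⟩
    obtain rfl : e = e' := Subtype.ext (Finset.eq_of_subset_of_card_le he (by rw [e.2, e'.2]))
    congr 1
    funext i
    exact absurd i.2.1 i.2.2

/-- Injections of `S i` and of an auxiliary sequence into `S i`, with disjoint ranges. -/
structure VertexSplitting {d : ℕ} (S : Fin d → Type v) where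
  main : ∀ i, S i → S i
  aux : ∀ i, ℕ → S i
  main_injective : ∀ i, (main i).Injective
  aux_injective : ∀ i, (aux i).Injective
  main_ne_aux : ∀ i s n, main i s ≠ aux i n

theorem VertexSplitting.nonempty {d : ℕ} (S : Fin d → Type v)
    [∀ i, Countable (S i)] [∀ i, Infinite (S i)] : Nonempty (VertexSplitting S) := by
  have h : ∀ i, Nonempty (S i ⊕ ℕ ≃ S i) := fun i => nonempty_equiv_of_countable
  exact ⟨⟨fun i s => (h i).some (.inl s), fun i n => (h i).some (.inr n),
    fun i => (h i).some.injective.comp Sum.inl_injective,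
    fun i => (h i).some.injective.comp Sum.inr_injective,
    fun i s n hsn => Sum.inl_ne_inr ((h i).some.injective hsn)⟩⟩

namespace VertexSplitting

variable {d k : ℕ} {S : Fin d → Type v} (V : VertexSplitting S) {K : TopFace d k → Type u}

/-- The hyperedge that agrees with `t` on `c` and with the auxiliary vertices `p` elsewhere. -/
def glue {c : Finset (Fin d)} (t : EdgeAbove S c) (p : LinkIndex k c) : EdgeAbove S p.1.1.1 :=
  fun i => if h : i.1 ∈ c then V.main i (t ⟨i, h⟩) else V.aux i (p.2 ⟨i, i.2, h⟩)

/-- The colouring of the auxiliary link of the hyperedge `t`. -/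
def link {c : Finset (Fin d)} (t : EdgeAbove S c) (ω : PartiteColouring S K) :
    LinkColouring K c :=
  fun p => ω p.1.1 (V.glue t p)

/-- The colourings of the links of the proper restrictions of the hyperedge `t`. -/
def bdry (t : PartiteEdge S k) (ω : PartiteColouring S K) :
    ∀ b : {b : Face d k // b.1 ⊂ t.1.1}, LinkColouring K b.1.1 :=
  fun b => V.link (t.restrict b.1 b.2.subset).2 ω

/-- The hyperedge `w` contains the image of the hyperedge `t`. -/
def Contains {c e : Finset (Fin d)} (t : EdgeAbove S c) (w : EdgeAbove S e) : Prop :=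
  ∀ i (h : i ∈ c), ∃ h' : i ∈ e, w ⟨i, h'⟩ = V.main i (t ⟨i, h⟩)

/-- The only main vertices of a hyperedge in the link of `s` are those of `s`. Containing `t` would
make `t` a restriction of `s`, and the rank bound would force equality. -/
theorem not_contains_glue {t s : PartiteEdge S k} (hst : s ≠ t)
    (hc : s.1.1.card ≤ t.1.1.card) (p : LinkIndex k s.1.1) :
    ¬ V.Contains t.2 (V.glue s.2 p) := by
  intro h
  have key : ∀ i (hi : i ∈ t.1.1), ∃ h' : i ∈ s.1.1, s.2 ⟨i, h'⟩ = t.2 ⟨i, hi⟩ := by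
    intro i hi
    obtain ⟨h', hw⟩ := h i hi
    unfold glue at hw
    split_ifs at hw with his
    · exact ⟨his, V.main_injective i hw⟩
    · exact absurd hw.symm (V.main_ne_aux _ _ _)
  obtain ⟨⟨c, hck⟩, t⟩ := t
  obtain ⟨⟨b, hbk⟩, s⟩ := s
  obtain rfl : c = b := Finset.eq_of_subset_of_card_le (fun i hi => (key i hi).1) hc
  apply hst
  congr 1
  funext i
  exact (key i.1 i.2).2

theorem not_contains_glue_restrict (t : PartiteEdge S k)
    (b : {b : Face d k // b.1 ⊂ t.1.1}) (p : LinkIndex k b.1.1) :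
    ¬ V.Contains t.2 (V.glue (t.restrict b.1 b.2.subset).2 p) := by
  refine V.not_contains_glue (s := t.restrict b.1 b.2.subset) ?_ (Finset.card_le_card b.2.subset) p
  intro h
  exact b.2.ne (congrArg (fun t => t.1.1) h)

/-- If `f` fixes the image of `t` and sends all other vertices to auxiliary ones, then it sends
every hyperedge not containing `t` into the link of a proper restriction of `t`. -/
theorem exists_glue_eq {t : PartiteEdge S k} {f : ∀ i, S i → S i}
    (hf : ∀ i (h : i ∈ t.1.1), f i (V.main i (t.2 ⟨i, h⟩)) = V.main i (t.2 ⟨i, h⟩))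
    (hf' : ∀ i s, (∀ h : i ∈ t.1.1, s ≠ V.main i (t.2 ⟨i, h⟩)) → f i s ∈ Set.range (V.aux i))
    {e : TopFace d k} {w : EdgeAbove S e.1} (hw : ¬ V.Contains t.2 w) :
    ∃ (b : {b : Face d k // b.1 ⊂ t.1.1}) (hb : b.1.1 ⊆ e.1)
      (p : {i // i ∈ e.1 ∧ i ∉ b.1.1} → ℕ),
      (fun i : e.1 => f i (w i)) = V.glue (t.restrict b.1 b.2.subset).2 ⟨⟨e, hb⟩, p⟩ := by
  classical
  -- `b` records where `w` agrees with the image of `t`; it is proper because `w` does not contain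
  -- `t`.
  let b : Finset (Fin d) := t.1.1.filter fun i =>
    ∃ (h : i ∈ t.1.1) (h' : i ∈ e.1), w ⟨i, h'⟩ = V.main i (t.2 ⟨i, h⟩)
  have hbt : b ⊂ t.1.1 := by
    refine (Finset.filter_subset _ _).ssubset_of_ne fun hb => hw fun i hi => ?_
    rw [← hb] at hi
    obtain ⟨-, h, h', hi⟩ := Finset.mem_filter.1 hi
    exact ⟨h', hi⟩
  have hbe : b ⊆ e.1 := fun i hi => by
    obtain ⟨-, h, h', -⟩ := Finset.mem_filter.1 hi
    exact h'
  have hrange : ∀ i : {i // i ∈ e.1 ∧ i ∉ b}, f i (w ⟨i, i.2.1⟩) ∈ Set.range (V.aux i) :=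
    fun i => hf' _ _ fun h hi => i.2.2 (Finset.mem_filter.2 ⟨h, h, i.2.1, hi⟩)
  choose p hp using hrange
  refine ⟨⟨⟨b, (Finset.card_le_card hbt.subset).trans t.1.2⟩, hbt⟩, hbe, p, ?_⟩
  funext i
  unfold glue
  split_ifs with h
  · obtain ⟨-, h, h', hi⟩ := Finset.mem_filter.1 h
    rw [show w i = V.main i (t.2 ⟨i, h⟩) from hi, hf i.1 h]
    rfl
  · exact (hp ⟨i, i.2, h⟩).symm

variable [∀ e, MeasurableSpace (K e)]

theorem measurable_link {c : Finset (Fin d)} (t : EdgeAbove S c) :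
    Measurable (V.link t : PartiteColouring S K → LinkColouring K c) := by
  unfold link
  fun_prop

theorem measurable_bdry (t : PartiteEdge S k) :
    Measurable (V.bdry t : PartiteColouring S K → _) :=
  measurable_pi_lambda _ fun _ => V.measurable_link _

/-- The σ-algebra generated by the colours of the hyperedges that do not contain `t`. -/
abbrev awayFrom {c : Finset (Fin d)} (K : TopFace d k → Type u) [∀ e, MeasurableSpace (K e)]
    (t : EdgeAbove S c) : MeasurableSpace (PartiteColouring S K) :=
  ⨆ q : {q : Σ e : TopFace d k, EdgeAbove S e.1 // ¬ V.Contains t q.2},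
    MeasurableSpace.comap (fun ω : PartiteColouring S K => ω q.1.1 q.1.2) inferInstance

theorem measurable_apply_awayFrom {c : Finset (Fin d)} {t : EdgeAbove S c} {e : TopFace d k}
    {w : EdgeAbove S e.1} (h : ¬ V.Contains t w) :
    Measurable[V.awayFrom K t] fun ω : PartiteColouring S K => ω e w :=
  Measurable.mono (comap_measurable _)
    (le_iSup (fun q : {q : Σ e : TopFace d k, EdgeAbove S e.1 // ¬ V.Contains t q.2} =>
      MeasurableSpace.comap (fun ω : PartiteColouring S K => ω q.1.1 q.1.2) inferInstance)
      ⟨⟨e, w⟩, h⟩) le_rfl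

theorem awayFrom_le {c : Finset (Fin d)} (t : EdgeAbove S c) :
    V.awayFrom K t ≤ (inferInstance : MeasurableSpace (PartiteColouring S K)) := by
  refine iSup_le fun q => Measurable.comap_le ?_
  fun_prop

theorem measurable_link_awayFrom {t s : PartiteEdge S k} (hst : s ≠ t)
    (hc : s.1.1.card ≤ t.1.1.card) :
    Measurable[V.awayFrom K t.2] (V.link s.2 : PartiteColouring S K → _) :=
  @measurable_pi_lambda _ _ _ (V.awayFrom K t.2) _ _ fun p =>
    V.measurable_apply_awayFrom (V.not_contains_glue hst hc p)

theorem measurable_bdry_awayFrom (t : PartiteEdge S k) :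
    Measurable[V.awayFrom K t.2] (V.bdry t : PartiteColouring S K → _) :=
  @measurable_pi_lambda _ _ _ (V.awayFrom K t.2) _ _ fun b =>
    @measurable_pi_lambda _ _ _ (V.awayFrom K t.2) _ _ fun p =>
      V.measurable_apply_awayFrom (V.not_contains_glue_restrict t b p)

/-! ### Conditional independence of links -/

variable {μ : Measure (PartiteColouring S K)} [IsProbabilityMeasure μ]

/-- The conditional probability of a cylinder event about the link of `t`, given all hyperedges
that do not contain `t`, depends only on the links of the proper restrictions of `t`. -/
theorem condExp_link_cylinder [∀ i, Countable (S i)] (hμ : PartiteExchangeable μ)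
    (t : PartiteEdge S k)
    (s : Finset (LinkIndex k t.1.1)) {B : ∀ p : LinkIndex k t.1.1, Set (K p.1.1)}
    (hB : ∀ p, MeasurableSet (B p)) :
    μ⟦V.link t.2 ⁻¹' Set.pi s B|V.awayFrom K t.2⟧ =ᵐ[μ]
      μ⟦V.link t.2 ⁻¹' Set.pi s B|MeasurableSpace.comap (V.bdry t) inferInstance⟧ := by
  classical
  -- A cylinder uses only auxiliary vertices below some `N`; fixing just these leaves room in the
  -- reservoir for all the other vertices.
  obtain ⟨N, hN⟩ : ∃ N, ∀ p ∈ s, ∀ i, p.2 i < N := by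
    refine ⟨s.sup (fun p => Finset.univ.sup p.2) + 1, fun p hp i => Nat.lt_succ_of_le ?_⟩
    exact (Finset.le_sup (f := p.2) (Finset.mem_univ i)).trans
      (Finset.le_sup (f := fun p : LinkIndex k t.1.1 => Finset.univ.sup p.2) hp)
  choose f hf hfA hfN hfr using fun i => exists_injective_fixing_initial_segment
    (V.aux_injective i) (A := {s | ∃ h : i ∈ t.1.1, s = V.main i (t.2 ⟨i, h⟩)})
    (by rintro _ ⟨h, rfl⟩ ⟨n, hn⟩; exact V.main_ne_aux _ _ _ hn.symm) N
  have hE : MeasurableSet (V.link (K := K) t.2 ⁻¹' Set.pi s B) :=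
    V.measurable_link _ (MeasurableSet.pi s.countable_toSet fun p _ => hB p)
  refine condExp_ae_eq_of_measurePreserving (V.measurable_bdry_awayFrom t).comap_le
    (V.awayFrom_le t.2) (hμ.measurePreserving_reindex hf) ?_
    ((memLp_const 1).indicator hE) ?_
  · refine Measurable.of_comap_le ?_
    rw [MeasurableSpace.comap_iSup]
    refine iSup_le fun q => ?_
    rw [MeasurableSpace.comap_comp]
    refine @Measurable.comap_le _ _ (MeasurableSpace.comap (V.bdry t) inferInstance) _ _ ?_
    obtain ⟨b, hb, p, hp⟩ := V.exists_glue_eq (t := t) (f := f)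
      (fun i h => hfA i _ ⟨h, rfl⟩)
      (fun i s hs => hfr i s fun ⟨h, h'⟩ => hs h h') q.2
    have : (fun ω : PartiteColouring S K => ω q.1.1 q.1.2) ∘ PartiteColouring.reindex f =
        (fun z => z b ⟨⟨q.1.1, hb⟩, p⟩) ∘ V.bdry (K := K) t := by
      funext ω
      exact congrArg (ω q.1.1) hp
    rw [this]
    refine Measurable.comp ?_ (comap_measurable _)
    fun_prop
  · funext ω
    have : PartiteColouring.reindex f ω ∈ V.link t.2 ⁻¹' Set.pi s B ↔
        ω ∈ V.link t.2 ⁻¹' Set.pi s B := by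
      simp only [Set.mem_preimage, Set.mem_pi]
      refine forall₂_congr fun p hp => ?_
      have : (fun i : p.1.1.1 => f i (V.glue t.2 p i)) = V.glue t.2 p := by
        funext i
        unfold glue
        split_ifs with h
        · exact hfA _ _ ⟨h, rfl⟩
        · exact hfN _ _ (hN p hp _)
      change ω p.1.1 (fun i => f i (V.glue t.2 p i)) ∈ B p ↔ _
      rw [this]
      rfl
    simp only [Function.comp_apply, Set.indicator, this]

/-- The conditional law of the link of `t` given the links of the proper restrictions of `t`. -/
noncomputable abbrev linkKernel [∀ e, StandardBorelSpace (K e)] (μ : Measure (PartiteColouring S K))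
    [IsFiniteMeasure μ] (t : PartiteEdge S k) [Nonempty (LinkColouring K t.1.1)] :
    Kernel (∀ b : {b : Face d k // b.1 ⊂ t.1.1}, LinkColouring K b.1.1) (LinkColouring K t.1.1) :=
  condDistrib (V.link t.2) (V.bdry t) μ

/-- The link of `t` is conditionally independent of all hyperedges that do not contain `t`, given
the links of the proper restrictions of `t`. -/
theorem measure_link_inter [∀ i, Countable (S i)] [∀ e, StandardBorelSpace (K e)]
    (hμ : PartiteExchangeable μ) (t : PartiteEdge S k) [Nonempty (LinkColouring K t.1.1)]
    {A : Set (PartiteColouring S K)} (hA : MeasurableSet[V.awayFrom K t.2] A)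
    {B : Set (LinkColouring K t.1.1)} (hB : MeasurableSet B) :
    μ (V.link t.2 ⁻¹' B ∩ A) = ∫⁻ ω in A, V.linkKernel μ t (V.bdry t ω) B ∂μ := by
  have hA' := V.awayFrom_le t.2 _ hA
  have hl := V.measurable_link (K := K) t.2
  have hb := V.measurable_bdry (K := K) t
  let κ : Kernel (PartiteColouring S K) (LinkColouring K t.1.1) :=
    (V.linkKernel μ t).comap (V.bdry t) hb
  have : IsMarkovKernel κ := Kernel.IsMarkovKernel.comap _ _
  -- For fixed `A` both sides are finite measures in the link, so the cylinder case suffices.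
  have key : (μ.restrict A).map (V.link t.2) = (μ.restrict A).bind κ := by
    refine Measure.ext_of_finset_pi fun s B hB => ?_
    have hpi : MeasurableSet (Set.pi (s : Set (LinkIndex k t.1.1)) B) :=
      MeasurableSet.pi s.countable_toSet fun p _ => hB p
    rw [Measure.map_apply hl hpi, Measure.restrict_apply (hl hpi),
      Measure.bind_apply hpi κ.measurable.aemeasurable]
    have h1 := (condDistrib_ae_eq_condExp (μ := μ) hb hl hpi).trans
      (V.condExp_link_cylinder hμ t s hB).symm
    have h2 := setIntegral_condExp (V.awayFrom_le t.2)
      (f := (V.link t.2 ⁻¹' Set.pi s B).indicator fun _ => (1 : ℝ))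
      ((integrable_const (μ := μ) 1).indicator (hl hpi)) hA
    rw [← setIntegral_congr_ae hA' (h1.mono fun _ h _ => h),
      integral_indicator (hl hpi)] at h2
    have hfin : ∫⁻ ω in A, κ ω (Set.pi s B) ∂μ ≠ ⊤ :=
      ((lintegral_mono fun ω => prob_le_one).trans_lt
        (by simp)).ne
    rw [← ENNReal.toReal_eq_toReal_iff' (measure_ne_top _ _) hfin,
      ← integral_toReal (κ.measurable_coe hpi).aemeasurable (.of_forall fun _ => measure_lt_top _ _)]
    refine Eq.trans ?_ h2.symm
    simp [measureReal_def, Measure.restrict_apply (hl hpi)]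
  have := congrFun (congrArg DFunLike.coe key) B
  rwa [Measure.map_apply hl hB, Measure.restrict_apply (hl hB),
    Measure.bind_apply hB κ.measurable.aemeasurable] at this

/-- `measure_link_inter` equates two measures on the σ-algebra `awayFrom`, hence also their
integrals of functions measurable for it. -/
theorem lintegral_link_mul [∀ i, Countable (S i)] [∀ e, StandardBorelSpace (K e)]
    (hμ : PartiteExchangeable μ) (t : PartiteEdge S k) [Nonempty (LinkColouring K t.1.1)]
    {h : PartiteColouring S K → ENNReal} (hh : Measurable[V.awayFrom K t.2] h)
    {B : Set (LinkColouring K t.1.1)} (hB : MeasurableSet B) :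
    ∫⁻ ω, (V.link t.2 ⁻¹' B).indicator 1 ω * h ω ∂μ =
      ∫⁻ ω, V.linkKernel μ t (V.bdry t ω) B * h ω ∂μ := by
  have hle := V.awayFrom_le (K := K) t.2
  have hl := V.measurable_link (K := K) t.2
  have hκ : Measurable fun ω => V.linkKernel μ t (V.bdry t ω) B :=
    ((V.linkKernel μ t).measurable_coe hB).comp (V.measurable_bdry t)
  have hh' : Measurable h := hh.mono hle le_rfl
  have key : (μ.restrict (V.link t.2 ⁻¹' B)).trim hle =
      (μ.withDensity fun ω => V.linkKernel μ t (V.bdry t ω) B).trim hle := by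
    refine @Measure.ext _ (V.awayFrom K t.2) _ _ fun A hA => ?_
    rw [trim_measurableSet_eq hle hA, trim_measurableSet_eq hle hA,
      Measure.restrict_apply (hle _ hA), withDensity_apply _ (hle _ hA), Set.inter_comm]
    exact V.measure_link_inter hμ t hA hB
  calc ∫⁻ ω, (V.link t.2 ⁻¹' B).indicator 1 ω * h ω ∂μ
      = ∫⁻ ω in V.link t.2 ⁻¹' B, h ω ∂μ := by
        rw [← lintegral_indicator (hl hB)]
        refine lintegral_congr fun ω => ?_
        by_cases hω : ω ∈ V.link t.2 ⁻¹' B <;> simp [hω]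
    _ = ∫⁻ ω, h ω ∂(μ.withDensity fun ω => V.linkKernel μ t (V.bdry t ω) B) := by
        rw [← lintegral_trim hle hh, key, lintegral_trim hle hh]
    _ = _ := lintegral_withDensity_eq_lintegral_mul _ hκ hh'

/-- The links of several hyperedges of the same rank are conditionally independent given all links
of lower rank. -/
theorem lintegral_prod_link [∀ i, Countable (S i)] [∀ e, StandardBorelSpace (K e)]
    (hμ : PartiteExchangeable μ) (j : ℕ) [∀ c : Face d k, Nonempty (LinkColouring K c.1)]
    (s : Finset {t : PartiteEdge S k // t.1.1.card = j + 1})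
    {B : ∀ t : {t : PartiteEdge S k // t.1.1.card = j + 1}, Set (LinkColouring K t.1.1.1)}
    (hB : ∀ t, MeasurableSet (B t))
    {h : (∀ t : {t : PartiteEdge S k // t.1.1.card ≤ j}, LinkColouring K t.1.1.1) → ENNReal}
    (hh : Measurable h) :
    ∫⁻ ω, (∏ t ∈ s, (V.link t.1.2 ⁻¹' B t).indicator 1 ω) * h (fun t => V.link t.1.2 ω) ∂μ =
      ∫⁻ ω, (∏ t ∈ s, V.linkKernel μ t.1 (V.bdry t.1 ω) (B t)) *
        h (fun t => V.link t.1.2 ω) ∂μ := by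
  classical
  induction s using Finset.induction_on generalizing h with
  | empty => simp
  | insert t s ht ih =>
    simp_rw [Finset.prod_insert ht, mul_assoc]
    rw [V.lintegral_link_mul hμ t.1 ?_ (hB t)]
    -- The kernel factor for `t` depends only on links of rank at most `j`, so it is absorbed into
    -- `h` before the induction hypothesis is applied.
    · let h' : (∀ t : {t : PartiteEdge S k // t.1.1.card ≤ j}, LinkColouring K t.1.1.1) → ENNReal :=
        fun z => V.linkKernel μ t.1 (fun b => z ⟨t.1.restrict b.1 b.2.subset,
          Nat.le_of_lt_succ (lt_of_lt_of_eq (Finset.card_lt_card b.2) t.2)⟩) (B t) * h z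
      have hh' : Measurable h' := by
        refine Measurable.mul (((V.linkKernel μ t.1).measurable_coe (hB t)).comp ?_) hh
        exact measurable_pi_lambda _ fun _ => measurable_pi_apply _
      exact (lintegral_congr fun ω => mul_left_comm _ _ _).trans
        ((ih hh').trans (lintegral_congr fun ω => mul_left_comm _ _ _))
    · refine Measurable.mul (Finset.measurable_prod _ fun r hr => ?_) (hh.comp ?_)
      · refine (measurable_one.indicator (hB r)).comp (V.measurable_link_awayFrom ?_ ?_)
        · intro h
          exact ht (Subtype.ext h ▸ hr)
        · rw [r.2, t.2]
      · refine @measurable_pi_lambda _ _ _ (V.awayFrom K t.1.2) _ _ fun r => ?_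
        refine V.measurable_link_awayFrom ?_ ?_
        · intro h
          have := r.2
          rw [h, t.2] at this
          omega
        · rw [t.2]
          exact r.2.trans j.le_succ

/-- The link kernels depend on the position of `t` only through its face. -/
theorem linkKernel_congr [∀ e, StandardBorelSpace (K e)]
    (hμ : PartiteExchangeable μ) (c : Face d k) (t s : EdgeAbove S c.1)
    [Nonempty (LinkColouring K c.1)] :
    V.linkKernel μ ⟨c, t⟩ = V.linkKernel μ ⟨c, s⟩ := by
  classical
  -- Swapping the main vertices of `t` and `s` moves no auxiliary vertex, so it carries links over
  -- restrictions of one to links over restrictions of the other.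
  let g : ∀ i, Equiv.Perm (S i) := fun i =>
    if h : i ∈ c.1 then Equiv.swap (V.main i (t ⟨i, h⟩)) (V.main i (s ⟨i, h⟩)) else 1
  have hg : ∀ i, {x | g i x ≠ x}.Finite := by
    intro i
    by_cases h : i ∈ c.1
    · refine (Set.toFinite {V.main i (t ⟨i, h⟩), V.main i (s ⟨i, h⟩)}).subset fun x hx => ?_
      by_contra hx'
      simp only [Set.mem_insert_iff, Set.mem_singleton_iff, not_or] at hx'
      refine hx ?_
      simp only [g, h, dite_true]
      exact Equiv.swap_apply_of_ne_of_ne hx'.1 hx'.2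
    · simp [g, h]
  have hperm : Measurable (PartiteColouring.permute (K := K) g) :=
    PartiteColouring.measurable_reindex fun i => g i
  have hlink : ∀ (b : Finset (Fin d)) (hb : b ⊆ c.1) (ω : PartiteColouring S K),
      V.link (fun i : b => t ⟨i, hb i.2⟩) (PartiteColouring.permute g ω) =
        V.link (fun i : b => s ⟨i, hb i.2⟩) ω := by
    intro b hb ω
    funext p
    refine congrArg (ω p.1.1) (funext fun i => ?_)
    unfold glue
    by_cases h : i.1 ∈ b
    · simp only [h, hb h, g, dite_true, Equiv.swap_apply_left]
    · simp only [h, dite_false]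
      by_cases h' : i.1 ∈ c.1
      · simp only [g, h', dite_true]
        exact Equiv.swap_apply_of_ne_of_ne (V.main_ne_aux _ _ _).symm (V.main_ne_aux _ _ _).symm
      · simp [g, h']
  have hmap : μ.map (fun ω => (V.bdry ⟨c, s⟩ ω, V.link s ω)) =
      μ.map (fun ω => (V.bdry ⟨c, t⟩ ω, V.link t ω)) := by
    conv_rhs => rw [← hμ g hg]
    rw [Measure.map_map ((V.measurable_bdry _).prodMk (V.measurable_link _)) hperm]
    congr 1
    funext ω
    exact (Prod.ext (funext fun b => hlink _ b.2.subset ω) (hlink _ subset_rfl ω)).symm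
  -- `condKernel` depends on a finiteness instance, so equality is transported for variable
  -- measures.
  have hcond : ∀ (ν ν' : Measure ((∀ b : {b : Face d k // b.1 ⊂ c.1}, LinkColouring K b.1.1) ×
      LinkColouring K c.1)) [IsFiniteMeasure ν] [IsFiniteMeasure ν'], ν = ν' →
      ν.condKernel = ν'.condKernel := by
    rintro ν ν' _ _ rfl
    rfl
  unfold linkKernel
  rw [condDistrib, condDistrib]
  exact hcond _ _ hmap.symm

end VertexSplitting

/-! ### Measurability and cylinder probabilities of the recipe -/

namespace PartiteIngredients

variable {d k : ℕ} {K : TopFace d k → Type u} [∀ e, MeasurableSpace (K e)]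
  (I : PartiteIngredients K) (S : Fin d → Type v)

theorem measurable_join (j : ℕ) : Measurable (I.join S j) := by
  refine measurable_pi_lambda _ fun t => ?_
  unfold join
  by_cases h : t.1.1.1.card ≤ j
  · simp only [h, dite_true]
    fun_prop
  · simp only [h, dite_false]
    fun_prop

theorem measurable_historyZero : Measurable (I.historyZero S) := by
  refine measurable_pi_lambda _ ?_
  rintro ⟨⟨⟨b, hb⟩, u⟩, h⟩
  obtain rfl : b = ∅ := Finset.card_eq_zero.1 (Nat.le_zero.1 h)
  exact measurable_id

theorem step_apply_pi (j : ℕ) (z : I.History S j)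
    (s : Finset {t : PartiteEdge S k // t.1.1.card = j + 1})
    {B : ∀ t : {t : PartiteEdge S k // t.1.1.card = j + 1}, Set (I.Z t.1.1)}
    (hB : ∀ t, MeasurableSet (B t)) :
    I.step S j z (Set.pi s B) =
      ∏ t ∈ s, I.P t.1.1 (nonempty_of_card_eq_succ S t) (I.boundary S t z) (B t) :=
  Measure.infinitePi_pi _ fun t _ => hB t

instance (j : ℕ) : IsMarkovKernel (I.step S j) :=
  ⟨fun z => inferInstanceAs (IsProbabilityMeasure (Measure.infinitePi
    fun t => I.P t.1.1 (nonempty_of_card_eq_succ S t) (I.boundary S t z)))⟩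

end PartiteIngredients

/-! ### The recipe with links as hidden variables -/

namespace VertexSplitting

variable {d k : ℕ} {S : Fin d → Type v} (V : VertexSplitting S) {K : TopFace d k → Type u}
  [∀ e, MeasurableSpace (K e)] [∀ e, StandardBorelSpace (K e)]
  [∀ i, Nonempty (S i)]
  (μ : Measure (PartiteColouring S K)) [IsProbabilityMeasure μ]
  [∀ c : Face d k, Nonempty (LinkColouring K c.1)]

/-- The ingredients whose colour spaces are the spaces of colourings of links. -/
noncomputable def ingredients : PartiteIngredients K where
  Z b := LinkColouring K b.1
  measurableSpace _ := inferInstance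
  standardBorel _ := inferInstance
  top e := MeasurableEquiv.piUnique fun p : LinkIndex k e.1 => K p.1.1
  μ₀ := μ.map (V.link fun _ => Classical.arbitrary _)
  isProbabilityMeasure := Measure.isProbabilityMeasure_map (V.measurable_link _).aemeasurable
  P c _ := V.linkKernel μ ⟨c, fun _ => Classical.arbitrary _⟩
  isMarkovKernel _ _ := inferInstance

/-- The links of all hyperedges of rank at most `j`. -/
def history (j : ℕ) (ω : PartiteColouring S K) : (V.ingredients μ).History S j :=
  fun t => V.link t.1.2 ω

/-- The links of all hyperedges of rank `j`. -/
def layer (j : ℕ) (ω : PartiteColouring S K) : (V.ingredients μ).Layer S j :=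
  fun t => V.link t.1.2 ω

theorem measurable_history (j : ℕ) : Measurable (V.history μ j) :=
  measurable_pi_lambda _ fun _ => V.measurable_link _

theorem measurable_layer (j : ℕ) : Measurable (V.layer μ j) :=
  measurable_pi_lambda _ fun _ => V.measurable_link _

theorem join_history_layer (j : ℕ) (ω : PartiteColouring S K) :
    (V.ingredients μ).join S j (V.history μ j ω, V.layer μ (j + 1) ω) =
      V.history μ (j + 1) ω := by
  funext t
  unfold PartiteIngredients.join
  split_ifs <;> rfl

variable {μ}
variable [∀ i, Countable (S i)]

/-- This is `lintegral_prod_link` with `h` the indicator of an event in the history;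
`linkKernel_congr` replaces each kernel by the one chosen for its face. -/
theorem map_history_layer (hμ : PartiteExchangeable μ) (j : ℕ) :
    μ.map (fun ω => (V.history μ j ω, V.layer μ (j + 1) ω)) =
      μ.map (V.history μ j) ⊗ₘ (V.ingredients μ).step S j := by
  have hH := V.measurable_history μ j
  have hL := V.measurable_layer μ (j + 1)
  have hHL := hH.prodMk hL
  have := Measure.isProbabilityMeasure_map (μ := μ) hH.aemeasurable
  have := Measure.isProbabilityMeasure_map (μ := μ) hHL.aemeasurable
  refine Measure.ext_prod fun {A L} hA hL' => ?_
  let κ := (V.ingredients μ).step S j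
  have hA' := hH hA
  have key : (μ.restrict (V.history μ j ⁻¹' A)).map (V.layer μ (j + 1)) =
      ((μ.map (V.history μ j)).restrict A).bind κ := by
    refine Measure.ext_of_finset_pi fun s B hB => ?_
    have hpi : MeasurableSet
        (Set.pi (s : Set {t : PartiteEdge S k // t.1.1.card = j + 1}) B) :=
      MeasurableSet.pi s.countable_toSet fun p _ => hB p
    have hind : Measurable (A.indicator (1 : (V.ingredients μ).History S j → ENNReal)) :=
      measurable_one.indicator hA
    have hκm : Measurable fun z => κ z (Set.pi s B) := κ.measurable_coe hpi
    rw [Measure.map_apply hL hpi, Measure.restrict_apply (hL hpi),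
      Measure.bind_apply hpi κ.measurable.aemeasurable, setLIntegral_map hA hκm hH,
      ← lintegral_indicator hA', ← lintegral_indicator_one ((hL hpi).inter hA')]
    have := V.lintegral_prod_link hμ j s hB hind
    refine Eq.trans (lintegral_congr fun ω => ?_) (this.trans (lintegral_congr fun ω => ?_))
    · rw [Set.inter_indicator_one, Pi.mul_apply]
      refine congrArg (· * _) ?_
      by_cases hω : ω ∈ V.layer μ (j + 1) ⁻¹' Set.pi s B
      · rw [Set.indicator_of_mem hω]
        exact (Finset.prod_eq_one fun t ht =>
          Set.indicator_of_mem (s := V.link t.1.2 ⁻¹' B t) (hω t ht) _).symm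
      · rw [Set.indicator_of_notMem hω]
        obtain ⟨t, ht, htB⟩ : ∃ t ∈ s, V.link t.1.2 ω ∉ B t := by
          by_contra! h
          exact hω h
        exact (Finset.prod_eq_zero ht
          (Set.indicator_of_notMem (s := V.link t.1.2 ⁻¹' B t) htB _)).symm
    · by_cases hω : V.history μ j ω ∈ A
      · rw [Set.indicator_of_mem (s := V.history μ j ⁻¹' A) hω]
        refine Eq.trans ?_ ((V.ingredients μ).step_apply_pi S j (V.history μ j ω) s hB).symm
        refine (congrArg _ (Set.indicator_of_mem hω _)).trans ((mul_one _).trans ?_)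
        refine Finset.prod_congr rfl fun t _ => ?_
        rw [V.linkKernel_congr hμ t.1.1 t.1.2 fun _ => Classical.arbitrary _]
        rfl
      · rw [Set.indicator_of_notMem (s := V.history μ j ⁻¹' A) hω]
        exact (congrArg _ (Set.indicator_of_notMem hω _)).trans (mul_zero _)
  have := congrFun (congrArg DFunLike.coe key) L
  rw [Measure.map_apply hL hL', Measure.restrict_apply (hL hL'),
    Measure.bind_apply hL' κ.measurable.aemeasurable] at this
  rw [Measure.map_apply hHL (hA.prod hL'), Measure.compProd_apply_prod hA hL', ← this,
    Set.mk_preimage_prod, Set.inter_comm]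

theorem law_ingredients (hμ : PartiteExchangeable μ) (j : ℕ) :
    (V.ingredients μ).law S j = μ.map (V.history μ j) := by
  induction j with
  | zero =>
    refine (Measure.map_map ((V.ingredients μ).measurable_historyZero S)
      (V.measurable_link _)).trans ?_
    congr 1
    funext ω t
    obtain ⟨⟨⟨b, hb⟩, u⟩, h⟩ := t
    obtain rfl : b = ∅ := Finset.card_eq_zero.1 (Nat.le_zero.1 h)
    exact congrArg (fun u => V.link u ω) (Subsingleton.elim (α := EdgeAbove S ∅) _ _)
  | succ j ih =>
    rw [PartiteIngredients.law, ih, ← V.map_history_layer hμ, Measure.map_map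
      ((V.ingredients μ).measurable_join S j)
      ((V.measurable_history μ j).prodMk (V.measurable_layer μ (j + 1)))]
    exact congrArg (fun f => μ.map f) (funext (V.join_history_layer μ j))

/-- The links at rank `k` are the colours of the main copy, so the recipe yields the image of `μ`
under reindexing by `main`, which is `μ`. -/
theorem ingredients_yields (hμ : PartiteExchangeable μ) : (V.ingredients μ).Yields μ := by
  unfold PartiteIngredients.Yields
  have hc : Measurable ((V.ingredients μ).colouring S) :=
    measurable_pi_lambda _ fun e => measurable_pi_lambda _ fun w =>
      ((V.ingredients μ).top e).measurable.comp (measurable_pi_apply _)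
  rw [V.law_ingredients hμ, Measure.map_map hc (V.measurable_history μ k)]
  refine Eq.trans ?_ (hμ.measurePreserving_reindex V.main_injective).map_eq
  congr 1
  funext ω e w
  change ω e (V.glue w (default : LinkIndex k e.1)) = ω e _
  congr 1
  funext i
  exact dif_pos i.2

end VertexSplitting

theorem theorem3p24 {d k : ℕ} (hkd : k ≤ d) (S : Fin d → Type v)
    [∀ i, Countable (S i)] [∀ i, Infinite (S i)]
    (K : TopFace d k → Type u) [∀ e, MeasurableSpace (K e)] [∀ e, StandardBorelSpace (K e)]
    (μ : Measure (PartiteColouring S K)) [IsProbabilityMeasure μ]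
    (hμ : PartiteExchangeable μ) :
    ∃ I : PartiteIngredients K, I.Yields μ := by
  obtain ⟨V⟩ := VertexSplitting.nonempty S
  -- One colouring supplies a point of every link space, as the conditional distributions require.
  obtain ⟨ω⟩ := μ.nonempty_of_neZero
  have : ∀ c : Face d k, Nonempty (LinkColouring K c.1) :=
    fun c => ⟨V.link (fun _ => Classical.arbitrary _) ω⟩
  exact ⟨V.ingredients μ, V.ingredients_yields hμ⟩
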